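/- Let $n\ge 1$ and let $A=a_1a_2\cdots a_n$ be a permutation of $[n]=\{1,\dots,n\}$. An ascent of $A$ is an index $i$ with $1\le i\le n-1$ and $a_i<a_{i+1}$; an inversion of $A$ is a pair $(i,j)$ with $1\le i<j\le n$ and $a_i>a_j$. Call $A$ even or odd according to whether its number of inversions is even or odd, and call $A$ parity-alternate if its entries are alternately even and odd, i.e. $a_i$ and $a_{i+1}$ have opposite parity for all $1\le i\le n-1$. Let $D_{n,k}$ (the signed Eulerian number) be the number of even permutations of $[n]$ with exactly $k$ ascents minus the number of odd permutations of $[n]$ with exactly $k$ ascents, and let $R_{n,k}$ be the number of even parity-alternate permutations of $[n]$ with exactly $k$ ascents minus the number of odd ones. In particular $R_{n,k}=0$ unless $0\le k\le n-1$ (for $n\ge 1$); for $n=0$ only the empty permutation is counted, so $R_{0,0}=1$ and $R_{0,k}=0$ for $k\ne 0$. **Theorem 4.3.** For all integers $n\ge 1$ and all integers $k$ with $0\le k\le n-1$, $$R_{n,k}=D_{n,k},$$ and $$R_{n,k}=\begin{cases}(n-k)\,R_{n-1,k-1}+(k+1)\,R_{n-1,k}, & \text{if } n \text{ is odd},\\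 R_{n-1,k-1}-R_{n-1,k}, & \text{if } n \text{ is even}.\end{cases}$$ -/

import Mathlib

namespace PAP

/-- A permutation `a₁ a₂ ⋯ aₙ` of `[n] = {1, …, n}` is modelled by `A : Equiv.Perm (Fin n)`:
`entry A i` is the entry at the (zero-based) position `i`, an integer between `1` and `n`. -/
def entry {n : ℕ} (A : Equiv.Perm (Fin n)) (i : Fin n) : ℕ := (A i : ℕ) + 1

/-- The number of ascents: adjacent pairs of positions `(i, i + 1)` with `aᵢ < aᵢ₊₁`. -/
def asc {n : ℕ} (A : Equiv.Perm (Fin n)) : ℕ :=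
  (Finset.univ.filter fun p : Fin n × Fin n =>
    (p.1 : ℕ) + 1 = (p.2 : ℕ) ∧ entry A p.1 < entry A p.2).card

/-- The number of inversions: pairs of positions `i < j` with `aᵢ > aⱼ`. -/
def inv {n : ℕ} (A : Equiv.Perm (Fin n)) : ℕ :=
  (Finset.univ.filter fun p : Fin n × Fin n =>
    p.1 < p.2 ∧ entry A p.2 < entry A p.1).card

/-- The permutation is parity-alternate: of any two adjacent entries, one is even and the
other is odd. -/
def IsParityAlternate {n : ℕ} (A : Equiv.Perm (Fin n)) : Prop :=
  ∀ i j : Fin n, (i : ℕ) + 1 = (j : ℕ) → (Even (entry A i) ↔ Odd (entry A j))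

instance {n : ℕ} : DecidablePred (IsParityAlternate (n := n)) := fun A =>
  inferInstanceAs (Decidable (∀ i j : Fin n, (i : ℕ) + 1 = (j : ℕ) →
    (Even (entry A i) ↔ Odd (entry A j))))

/-- `E n k`: all permutations of `[n]` with exactly `k` ascents. The index `k` is an integer, so
that `k - 1` makes sense for `k = 0`; the set is empty for `k < 0`. -/
def E (n : ℕ) (k : ℤ) : Finset (Equiv.Perm (Fin n)) :=
  Finset.univ.filter fun A => (asc A : ℤ) = k

/-- The members of `E n k` with an even number of inversions. -/
def Eeven (n : ℕ) (k : ℤ) : Finset (Equiv.Perm (Fin n)) :=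
  (E n k).filter fun A => Even (inv A)

/-- The members of `E n k` with an odd number of inversions. -/
def Eodd (n : ℕ) (k : ℤ) : Finset (Equiv.Perm (Fin n)) :=
  (E n k).filter fun A => Odd (inv A)

/-- The signed Eulerian number. -/
def D (n : ℕ) (k : ℤ) : ℤ := ((Eeven n k).card : ℤ) - ((Eodd n k).card : ℤ)

/-- `Xi n k`: all parity-alternate permutations of `[n]` with exactly `k` ascents. -/
def Xi (n : ℕ) (k : ℤ) : Finset (Equiv.Perm (Fin n)) :=
  (E n k).filter fun A => IsParityAlternate A

/-- The number of even parity-alternate permutations with `k` ascents. -/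
def P (n : ℕ) (k : ℤ) : ℕ := (Xi n k ∩ Eeven n k).card

/-- The number of odd parity-alternate permutations with `k` ascents. -/
def Q (n : ℕ) (k : ℤ) : ℕ := (Xi n k ∩ Eodd n k).card

/-- The signed count of parity-alternate permutations with `k` ascents. -/
def R (n : ℕ) (k : ℤ) : ℤ := (P n k : ℤ) - (Q n k : ℤ)

end PAP

/-! Exchanging two consecutive values whose positions have equal parity reverses the sign and keeps
the ascents, since the positions are not adjacent. Applied to the least such pair it is an
involution, so only permutations whose successive values alternate in position parity survive.
Passing to the inverse, these are the parity-alternate ones, and R = D (`R_eq_D`).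

The recurrences are proved for D by inserting the maximum. For n odd, the same cancellation among
the smaller values removes the permutations whose maximum has odd zero-based position
(`sum_odd_pos_max`). A weight (-1)^position is therefore free; it cancels the sign of the insertion
and leaves the classical Eulerian count. For n even, exchanging the two largest values leaves only
the permutations where they are adjacent: two insertions of opposite sign, one of which gains an
ascent. -/

namespace PAP

open Finset Equiv

/-! ### Signed counts as sums of signs -/

/-- The sign of a permutation, as an integer. -/
def sgn {n : ℕ} (A : Perm (Fin n)) : ℤ := ((Perm.sign A : ℤˣ) : ℤ)

theorem sgn_eq_neg_one_pow_inv {n : ℕ} (A : Perm (Fin n)) : sgn A = (-1) ^ inv A := by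
  have h : (Perm.sign A) = (-1) ^ inv A := by
    rw [Perm.sign_eq_prod_prod_Ioi, inv, ← Finset.prod_const, Finset.prod_filter,
      ← Finset.univ_product_univ, Finset.prod_product]
    refine Finset.prod_congr rfl fun i _ => ?_
    have : Finset.Ioi i = Finset.univ.filter (fun j => i < j) := by ext; simp
    rw [this, Finset.prod_filter]
    refine Finset.prod_congr rfl fun j _ => ?_
    by_cases hij : i < j
    · have hne : A i ≠ A j := fun h => hij.ne (A.injective h)
      rcases lt_or_gt_of_ne hne with h | h
      · have h' : ¬ A j < A i := not_lt.mpr h.le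
        simp [hij, entry, h, h']
      · have h' : ¬ A i < A j := not_lt.mpr h.le
        simp [hij, entry, h, h']
    · simp [hij]
  rw [sgn, h]; simp

theorem card_even_sub_card_odd {n : ℕ} (s : Finset (Perm (Fin n))) :
    ((s.filter fun A => Even (inv A)).card : ℤ) - ((s.filter fun A => Odd (inv A)).card : ℤ)
      = ∑ A ∈ s, sgn A := by
  rw [Finset.card_filter, Finset.card_filter]
  push_cast
  rw [← Finset.sum_sub_distrib]
  refine Finset.sum_congr rfl fun A _ => ?_
  rw [sgn_eq_neg_one_pow_inv]
  rcases Nat.even_or_odd (inv A) with h | h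
  · have h' : ¬ Odd (inv A) := Nat.not_odd_iff_even.mpr h
    simp [h, h.neg_one_pow]
  · have h' : ¬ Even (inv A) := Nat.not_even_iff_odd.mpr h
    simp [h, h.neg_one_pow]

theorem D_eq_sum (n : ℕ) (k : ℤ) :
    D n k = ∑ A : Perm (Fin n), if (asc A : ℤ) = k then sgn A else 0 := by
  rw [D, Eeven, Eodd, card_even_sub_card_odd, E, Finset.sum_filter]

theorem R_eq_sum (n : ℕ) (k : ℤ) :
    R n k = ∑ A : Perm (Fin n), if (asc A : ℤ) = k ∧ IsParityAlternate A then sgn A else 0 := by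
  have h1 : Xi n k ∩ Eeven n k = (Xi n k).filter fun A => Even (inv A) := by
    ext A; simp only [Xi, Eeven, Finset.mem_inter, Finset.mem_filter]; tauto
  have h2 : Xi n k ∩ Eodd n k = (Xi n k).filter fun A => Odd (inv A) := by
    ext A; simp only [Xi, Eodd, Finset.mem_inter, Finset.mem_filter]; tauto
  rw [R, P, Q, h1, h2, card_even_sub_card_odd, Xi, E, Finset.filter_filter, Finset.sum_filter]

/-! ### The sign-reversing exchange -/

/-- Exchanging two consecutive values in non-adjacent positions preserves the ascents. -/
theorem asc_swap_mul {n : ℕ} (A : Perm (Fin n)) {a b : Fin n} (hab : (a : ℕ) + 1 = b)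
    (h1 : (A.symm a : ℕ) + 1 ≠ A.symm b) (h2 : (A.symm b : ℕ) + 1 ≠ A.symm a) :
    asc (swap a b * A) = asc A := by
  unfold asc
  congr 1
  refine Finset.filter_congr fun p _ => and_congr_right fun hp => ?_
  have key : ∀ i, A i = a ↔ i = A.symm a := fun i => by rw [Equiv.eq_symm_apply]
  have key' : ∀ i, A i = b ↔ i = A.symm b := fun i => by rw [Equiv.eq_symm_apply]
  have e1 : ¬ (A p.1 = a ∧ A p.2 = b) := by
    rintro ⟨ha, hb⟩; rw [key] at ha; rw [key'] at hb; rw [← ha, ← hb] at h1; exact h1 hp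
  have e2 : ¬ (A p.1 = b ∧ A p.2 = a) := by
    rintro ⟨hb, ha⟩; rw [key] at ha; rw [key'] at hb; rw [← ha, ← hb] at h2; exact h2 hp
  simp only [entry, Perm.mul_apply, Equiv.swap_apply_def]
  simp only [Fin.ext_iff] at e1 e2
  split_ifs with c1 c2 c3 c4 c5 <;> simp only [Fin.ext_iff] at * <;> omega

theorem sgn_swap_mul {n : ℕ} (A : Perm (Fin n)) {a b : Fin n} (hab : a ≠ b) :
    sgn (swap a b * A) = - sgn A := by
  simp [sgn, Perm.sign_mul, Perm.sign_swap hab]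

/-- The position of the value `v`, as a function on natural numbers. -/
def pos {n : ℕ} (A : Perm (Fin n)) (v : ℕ) : ℕ := if h : v < n then (A.symm ⟨v, h⟩ : ℕ) else 0

theorem pos_val {n : ℕ} (A : Perm (Fin n)) (a : Fin n) : pos A a = A.symm a := by simp [pos]

theorem pos_swap_mul {n : ℕ} (A : Perm (Fin n)) (a b : Fin n) (w : ℕ) :
    pos (swap a b * A) w = pos A (swap (a : ℕ) b w) := by
  have hs : (swap a b * A).symm = A⁻¹ * swap a b := by
    change (swap a b * A)⁻¹ = _
    rw [mul_inv_rev, Equiv.swap_inv]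
  by_cases h : w < n
  · have e : swap (a : ℕ) b w = ((swap a b ⟨w, h⟩ : Fin n) : ℕ) := by
      simp only [Equiv.swap_apply_def, Fin.ext_iff]
      split_ifs <;> rfl
    rw [e, pos_val, pos, dif_pos h, hs]; rfl
  · have e : swap (a : ℕ) b w = w := Equiv.swap_apply_of_ne_of_ne (by omega) (by omega)
    rw [e, pos, pos, dif_neg h, dif_neg h]

/-- Some two consecutive values smaller than `b` have positions of the same parity. -/
def HasClash {n : ℕ} (b : ℕ) (A : Perm (Fin n)) : Prop :=
  ∃ v, v + 1 < b ∧ pos A v % 2 = pos A (v + 1) % 2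

/-- The signed sum of a weight over the permutations with a clash vanishes, as soon as the weight
is not changed by exchanging two clashing consecutive values. -/
theorem sum_hasClash {n b : ℕ} (hb : b ≤ n) (w : Perm (Fin n) → ℤ)
    (hw : ∀ (A : Perm (Fin n)) (x y : Fin n), (x : ℕ) + 1 = y → (y : ℕ) < b →
      pos A x % 2 = pos A y % 2 → w (swap x y * A) = w A) [DecidablePred (HasClash (n := n) b)] :
    ∑ A ∈ Finset.univ.filter (HasClash (n := n) b), w A * sgn A = 0 := by
  classical
  have hlt : ∀ v, v + 1 < b → v + 1 < n := fun v h => lt_of_lt_of_le h hb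
  -- The exchange changes no position parity, so the set of clashes, and with it the least clash,
  -- stays the same.
  have mv : ∀ (A : Perm (Fin n)) (x y : Fin n), pos A x % 2 = pos A y % 2 →
      ∀ u, pos (swap x y * A) u % 2 = pos A u % 2 := by
    intro A x y h u
    rw [pos_swap_mul, Equiv.swap_apply_def]
    split_ifs with h1 h2
    · rw [h1, h]
    · rw [h2, h]
    · rfl
  let g : (A : Perm (Fin n)) → HasClash b A → Perm (Fin n) := fun A h =>
    swap ⟨Nat.find h, by have := hlt _ (Nat.find_spec h).1; omega⟩
      ⟨Nat.find h + 1, hlt _ (Nat.find_spec h).1⟩ * A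
  have gpos : ∀ A h u, pos (g A h) u % 2 = pos A u % 2 := fun A h u =>
    mv A _ _ (Nat.find_spec h).2 u
  have gclash : ∀ A h, HasClash b (g A h) := fun A h => by
    refine ⟨Nat.find h, (Nat.find_spec h).1, ?_⟩
    rw [gpos, gpos]; exact (Nat.find_spec h).2
  have gfind : ∀ A h, Nat.find (gclash A h) = Nat.find h := fun A h => by
    apply Nat.find_congr'
    intro u
    rw [gpos, gpos]
  refine Finset.sum_involution (fun A hA => g A (Finset.mem_filter.mp hA).2) ?_ ?_ ?_ ?_
  · intro A hA
    have h := (Finset.mem_filter.mp hA).2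
    have h1 : w (g A h) = w A := hw A _ _ rfl (Nat.find_spec h).1 (Nat.find_spec h).2
    have h2 : sgn (g A h) = - sgn A := sgn_swap_mul A (by simp [Fin.ext_iff])
    rw [h1, h2]; ring
  · intro A hA hne heq
    have h := (Finset.mem_filter.mp hA).2
    have h2 : sgn (g A h) = - sgn A := sgn_swap_mul A (by simp [Fin.ext_iff])
    rw [show g A h = A from heq] at h2
    have : sgn A = 0 := by omega
    exact hne (by rw [this, mul_zero])
  · intro A hA
    exact Finset.mem_filter.mpr ⟨Finset.mem_univ _, gclash _ _⟩
  · intro A hA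
    have h := (Finset.mem_filter.mp hA).2
    change g (g A h) (gclash A h) = A
    have := gfind A h
    simp only [g] at this ⊢
    simp only [this, Equiv.swap_mul_self_mul]

theorem asc_swap_mul_of_pos {n : ℕ} (A : Perm (Fin n)) {x y : Fin n} (hxy : (x : ℕ) + 1 = y)
    (h : pos A x % 2 = pos A y % 2) : asc (swap x y * A) = asc A := by
  rw [pos_val, pos_val] at h
  exact asc_swap_mul A hxy (by omega) (by omega)

theorem parity_of_alternating {n : ℕ} (f : ℕ → ℕ)
    (h : ∀ i, i + 1 < n → f i % 2 ≠ f (i + 1) % 2) :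
    ∀ i, i < n → f i % 2 = (i + f 0) % 2 := by
  intro i
  induction i with
  | zero => intro _; simp
  | succ i ih =>
    intro hi
    have h1 := ih (by omega)
    have h2 := h i hi
    omega

/-- Without a clash, `pos A v` has the parity of `v + pos A 0`: a relation between values and
positions that passes to the inverse. -/
theorem not_hasClash_symm {n : ℕ} (A : Perm (Fin n)) (h : ¬ HasClash n A) :
    ¬ HasClash n A.symm := by
  rintro ⟨v, hv, he⟩
  have h' : ∀ i, i + 1 < n → pos A i % 2 ≠ pos A (i + 1) % 2 := fun i hi hne => h ⟨i, hi, hne⟩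
  have key := parity_of_alternating (n := n) (pos A) h'
  have inverse : ∀ u, u < n → pos A (pos A.symm u) = u := fun u hu => by
    rw [pos, pos]; simp [hu]
  have bound : ∀ u, u < n → pos A.symm u < n := fun u hu => by
    rw [pos]; simp [hu]
  have k1 := key _ (bound v (by omega))
  have k2 := key _ (bound (v + 1) hv)
  rw [inverse _ (by omega)] at k1
  rw [inverse _ hv] at k2
  omega

theorem isParityAlternate_iff {n : ℕ} (A : Perm (Fin n)) :
    IsParityAlternate A ↔ ¬ HasClash n A := by
  have : IsParityAlternate A ↔ ¬ HasClash n A.symm := by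
    constructor
    · rintro h ⟨v, hv, he⟩
      have := h ⟨v, by omega⟩ ⟨v + 1, hv⟩ rfl
      rw [pos, pos, dif_pos (by omega), dif_pos hv] at he
      simp only [entry, Nat.even_iff, Nat.odd_iff] at this
      simp only [Equiv.symm_symm] at he
      omega
    · intro h i j hij
      by_contra hc
      refine h ⟨i, by omega, ?_⟩
      rw [hij, pos_val, pos_val]
      simp only [entry, Nat.even_iff, Nat.odd_iff] at hc
      simp only [Equiv.symm_symm]
      omega
  rw [this]
  exact ⟨fun h => by simpa using not_hasClash_symm _ h, fun h => not_hasClash_symm _ h⟩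

theorem R_eq_D (n : ℕ) (k : ℤ) : R n k = D n k := by
  classical
  have h := sum_hasClash (n := n) le_rfl (fun A => if (asc A : ℤ) = k then 1 else 0)
    (fun A x y hxy _ hp => by rw [asc_swap_mul_of_pos A hxy hp])
  rw [Finset.sum_filter] at h
  rw [R_eq_sum, D_eq_sum, ← sub_eq_zero, ← Finset.sum_sub_distrib, ← neg_eq_zero,
    ← Finset.sum_neg_distrib]
  refine Eq.trans ?_ h
  refine Finset.sum_congr rfl fun A _ => ?_
  have hA := isParityAlternate_iff A
  by_cases h1 : HasClash n A <;> by_cases h2 : (asc A : ℤ) = k <;> simp [hA, h1, h2]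

/-- For an odd number of letters, the permutations whose maximal entry has an odd number of
entries to its left cancel. -/
theorem sum_odd_pos_max {N : ℕ} (hN : Even N) (k : ℤ) :
    ∑ A : Perm (Fin (N + 1)), (if (asc A : ℤ) = k then sgn A * (-1) ^ pos A N else 0)
      = D (N + 1) k := by
  classical
  have h := sum_hasClash (n := N + 1) (b := N) (by omega)
    -- The two sums differ by twice the sign, exactly where the maximum has odd position.
    (fun A => if (asc A : ℤ) = k ∧ Odd (pos A N) then 2 else 0)
    (fun A x y hxy hy hp => by
      rw [asc_swap_mul_of_pos A hxy hp, pos_swap_mul,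
        Equiv.swap_apply_of_ne_of_ne (by omega) (by omega)])
  rw [D_eq_sum, eq_comm, ← sub_eq_zero, ← Finset.sum_sub_distrib]
  rw [Finset.sum_filter] at h
  refine Eq.trans ?_ h
  refine Finset.sum_congr rfl fun A _ => ?_
  rcases Nat.even_or_odd (pos A N) with hp | hp
  · have hp' : ¬ Odd (pos A N) := Nat.not_odd_iff_even.mpr hp
    simp [hp.neg_one_pow, hp']
  · have hc : HasClash N A := by
      by_contra hc
      have alt : ∀ i, i + 1 < N → pos A i % 2 ≠ pos A (i + 1) % 2 :=
        fun i hi hne => hc ⟨i, hi, hne⟩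
      -- As `N` is even, the positions 0, …, `N` include one more even than odd. Alternating values
      -- below `N` would contribute 0 and the maximum -1.
      have total : ∑ v ∈ Finset.range (N + 1), (-1 : ℤ) ^ pos A v = 1 := by
        rw [Finset.sum_range]
        simp_rw [pos_val]
        rw [Equiv.sum_comp A.symm (fun i : Fin (N + 1) => (-1 : ℤ) ^ (i : ℕ)),
          ← Finset.sum_range (fun i => (-1 : ℤ) ^ i), neg_one_geom_sum]
        simp [hN, Nat.even_add_one]
      have par : ∀ v, v < N → (-1 : ℤ) ^ pos A v = (-1) ^ v * (-1) ^ pos A 0 := by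
        intro v hv
        rw [← pow_add, neg_one_pow_eq_pow_mod_two, parity_of_alternating _ alt v hv,
          ← neg_one_pow_eq_pow_mod_two]
      rw [Finset.sum_range_succ, Finset.sum_congr rfl
        (fun v hv => par v (Finset.mem_range.mp hv)), ← Finset.sum_mul, neg_one_geom_sum,
        hp.neg_one_pow] at total
      simp [hN] at total
    by_cases ha : (asc A : ℤ) = k
    · simp [hp.neg_one_pow, hp, hc, ha]; ring
    · simp [ha]

/-! ### Inserting a maximum -/

/-- The (zero-based) value in position `i`, as a function on natural numbers. -/
def val {n : ℕ} (A : Perm (Fin n)) (i : ℕ) : ℕ := if h : i < n then (A ⟨i, h⟩ : ℕ) else 0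

theorem val_fin {n : ℕ} (A : Perm (Fin n)) (i : Fin n) : val A i = A i := by simp [val]

theorem asc_eq_sum {n : ℕ} (A : Perm (Fin n)) :
    asc A = ∑ i ∈ Finset.range (n - 1), if val A i < val A (i + 1) then 1 else 0 := by
  rw [← Finset.card_filter, asc]
  refine Finset.card_bij (fun p _ => (p.1 : ℕ)) ?_ ?_ ?_
  · rintro ⟨i, j⟩ h
    obtain ⟨h1, h2⟩ := (Finset.mem_filter.mp h).2
    simp only [entry] at h1 h2
    rw [Finset.mem_filter, Finset.mem_range]
    dsimp only
    rw [h1, val_fin, val_fin]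
    exact ⟨by omega, by omega⟩
  · rintro ⟨i, j⟩ h ⟨i', j'⟩ h' e
    simp only [Finset.mem_filter, Finset.mem_univ, true_and] at h h' e
    simp only [Prod.mk.injEq, Fin.ext_iff]
    omega
  · intro i hi
    simp only [Finset.mem_filter, Finset.mem_range] at hi
    have h2 : i + 1 < n := by omega
    have h1 : i < n := by omega
    refine ⟨(⟨i, h1⟩, ⟨i + 1, h2⟩), ?_, rfl⟩
    have := hi.2
    rw [val, val, dif_pos h1, dif_pos h2] at this
    simpa [entry] using this

/-- Insert a new maximal entry in position `p`. -/
def insertMax {N : ℕ} (p : Fin (N + 1)) (B : Perm (Fin N)) : Perm (Fin (N + 1)) :=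
  (Fin.cycleRange (Fin.last N))⁻¹ * Perm.decomposeFin.symm (0, B) * Fin.cycleRange p

theorem insertMax_self {N : ℕ} (p : Fin (N + 1)) (B : Perm (Fin N)) :
    insertMax p B p = Fin.last N := by
  simp only [insertMax, Perm.mul_apply, Fin.cycleRange_self, Perm.decomposeFin_symm_apply_zero]
  exact Fin.cycleRange_symm_zero _

theorem insertMax_succAbove {N : ℕ} (p : Fin (N + 1)) (B : Perm (Fin N)) (j : Fin N) :
    insertMax p B (p.succAbove j) = (B j).castSucc := by
  simp only [insertMax, Perm.mul_apply, Fin.cycleRange_succAbove,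
    Perm.decomposeFin_symm_apply_succ, Equiv.swap_self, Equiv.refl_apply]
  rw [← Fin.succAbove_last_apply]
  exact Fin.cycleRange_symm_succ _ _

/-- The two cycles contribute (-1)^N and (-1)^p; the middle factor has the sign of `B`. -/
theorem sgn_insertMax {N : ℕ} (p : Fin (N + 1)) (B : Perm (Fin N)) :
    sgn (insertMax p B) = (-1) ^ (N + (p : ℕ)) * sgn B := by
  simp [sgn, insertMax, Perm.sign_mul, Fin.sign_cycleRange, Perm.decomposeFin.symm_sign, pow_add]
  ring

theorem insertMax_bijective (N : ℕ) :
    Function.Bijective fun x : Fin (N + 1) × Perm (Fin N) => insertMax x.1 x.2 := by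
  rw [Fintype.bijective_iff_injective_and_card]
  constructor
  · rintro ⟨p, B⟩ ⟨p', B'⟩ h
    simp only at h
    have hp : p = p' := by
      apply (insertMax p B).injective
      rw [insertMax_self, h, insertMax_self]
    subst hp
    have hB : B = B' := by
      ext j
      have := insertMax_succAbove p B j
      rw [h, insertMax_succAbove] at this
      rw [Fin.castSucc_injective _ this]
    rw [hB]
  · simp [Fintype.card_perm, Nat.factorial_succ]

theorem sum_perm_succ {N : ℕ} (F : Perm (Fin (N + 1)) → ℤ) :
    ∑ A, F A = ∑ B : Perm (Fin N), ∑ p : Fin (N + 1), F (insertMax p B) := by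
  rw [← Fintype.sum_bijective _ (insertMax_bijective N) (fun x => F (insertMax x.1 x.2)) F
    fun _ => rfl]
  exact Fintype.sum_prod_type_right fun x : Fin (N + 1) × Perm (Fin N) => F (insertMax x.1 x.2)

theorem pos_insertMax_max {N : ℕ} (p : Fin (N + 1)) (B : Perm (Fin N)) :
    pos (insertMax p B) N = p := by
  have : (insertMax p B).symm (Fin.last N) = p := by
    rw [Equiv.symm_apply_eq, insertMax_self]
  have h := pos_val (insertMax p B) (Fin.last N)
  rwa [Fin.val_last, this] at h

theorem pos_insertMax {N : ℕ} (p : Fin (N + 1)) (B : Perm (Fin N)) (u : Fin N) :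
    pos (insertMax p B) u = if pos B u < p then pos B u else pos B u + 1 := by
  have : (insertMax p B).symm u.castSucc = p.succAbove (B.symm u) := by
    rw [Equiv.symm_apply_eq, insertMax_succAbove, Equiv.apply_symm_apply]
  have h := pos_val (insertMax p B) u.castSucc
  rw [this] at h
  rw [pos_val B u, ← Fin.val_castSucc u, h, Fin.succAbove]
  simp only [Fin.lt_def, Fin.val_castSucc]
  split_ifs <;> rfl

theorem val_insertMax {N : ℕ} (p : Fin (N + 1)) (B : Perm (Fin N)) {i : ℕ} (hi : i ≤ N) :
    val (insertMax p B) i = if i < p then val B i else if i = p then N else val B (i - 1) := by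
  split_ifs with h1 h2
  · have hiN : i < N := by omega
    have e : p.succAbove ⟨i, hiN⟩ = ⟨i, by omega⟩ :=
      Fin.succAbove_of_castSucc_lt _ _ (by simpa [Fin.lt_def] using h1)
    have := insertMax_succAbove p B ⟨i, hiN⟩
    rw [e] at this
    rw [val, val, dif_pos (by omega), dif_pos hiN, this]; rfl
  · subst h2
    rw [val_fin, insertMax_self]; rfl
  · have hiN : i - 1 < N := by omega
    have e : p.succAbove ⟨i - 1, hiN⟩ = ⟨i, by omega⟩ := by
      rw [Fin.succAbove_of_le_castSucc _ _ (by simp [Fin.le_def]; omega)]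
      simp only [Fin.succ_mk, Fin.mk.injEq]; omega
    have := insertMax_succAbove p B ⟨i - 1, hiN⟩
    rw [e] at this
    rw [val, val, dif_pos (by omega), dif_pos hiN, this]; rfl

/-- The number of ascents gained by inserting a new maximum in position `p` of a word `g` of
length `N`. -/
def gain (N : ℕ) (g : ℕ → ℕ) (p : ℕ) : ℕ :=
  if 1 ≤ p ∧ ¬ (p < N ∧ g (p - 1) < g p) then 1 else 0

/-- Induction on the length from `N = p`, where the maximum is last. The first letter appended after
it settles the gain; later ones only shift pairs. -/
theorem sum_ascents_insert (g h : ℕ → ℕ) (M p : ℕ) (N : ℕ) (hpN : p ≤ N)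
    (hg : ∀ i, i < N → g i < M)
    (hh : ∀ i, i ≤ N → h i = if i < p then g i else if i = p then M else g (i - 1)) :
    (∑ i ∈ Finset.range N, if h i < h (i + 1) then 1 else 0)
      = (∑ i ∈ Finset.range (N - 1), if g i < g (i + 1) then 1 else 0) + gain N g p := by
  induction N, hpN using Nat.le_induction with
  | base =>
    rcases p with _ | q
    · simp [gain]
    · rw [Finset.sum_range_succ, hh q (by omega), hh (q + 1) le_rfl]
      have : ∀ i ∈ Finset.range q, (if h i < h (i + 1) then 1 else 0)
          = if g i < g (i + 1) then 1 else 0 := by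
        intro i hi
        have hi := Finset.mem_range.mp hi
        rw [hh i (by omega), hh (i + 1) (by omega), if_pos (show i < q + 1 by omega),
          if_pos (show i + 1 < q + 1 by omega)]
      rw [Finset.sum_congr rfl this]
      simp [gain, hg q (by omega)]
  | succ N hpN ih =>
    rw [Finset.sum_range_succ, ih (fun i hi => hg i (by omega)) (fun i hi => hh i (by omega)),
      hh N (by omega), hh (N + 1) le_rfl, Nat.add_sub_cancel]
    rcases N with _ | N
    · have : p = 0 := by omega
      have := hg 0 (by omega)
      subst p
      simp [gain]; omega
    · rw [Finset.sum_range_succ (n := N), Nat.add_sub_cancel]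
      have hgN := hg (N + 1) (by omega)
      rcases hpN.eq_or_lt with rfl | hlt
      · simp [gain]
        split_ifs <;> omega
      · have e1 : ¬ N + 1 < p := by omega
        have e2 : N + 1 ≠ p := by omega
        have e3 : ¬ N + 1 + 1 < p := by omega
        have e4 : N + 1 + 1 ≠ p := by omega
        have e5 : p < N + 1 + 1 := by omega
        have e6 : p < N + 1 := by omega
        simp [gain, e1, e2, e3, e4, e5, e6]
        ring

theorem asc_insertMax {N : ℕ} (p : Fin (N + 1)) (B : Perm (Fin N)) :
    asc (insertMax p B) = asc B + gain N (val B) p := by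
  rw [asc_eq_sum, asc_eq_sum, Nat.add_sub_cancel]
  refine sum_ascents_insert _ _ N p N (by omega) ?_ fun i hi => val_insertMax p B hi
  intro i hi
  rw [val, dif_pos hi]
  exact (B _).2

/-- Only the front and the gaps inside ascents gain nothing. -/
theorem sum_gain {N : ℕ} (B : Perm (Fin N)) :
    ∑ p : Fin (N + 1), (gain N (val B) p : ℤ) = N - asc B := by
  rw [← Finset.sum_range (fun p => (gain N (val B) p : ℤ)), Finset.sum_range_succ']
  have h : ∀ i ∈ Finset.range N, (gain N (val B) (i + 1) : ℤ)
      = 1 - if i + 1 < N ∧ val B i < val B (i + 1) then 1 else 0 := by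
    intro i _
    simp only [gain, Nat.add_sub_cancel]
    split_ifs <;> simp_all
  rw [Finset.sum_congr rfl h, Finset.sum_sub_distrib, asc_eq_sum]
  rcases N with _ | M
  · simp [gain]
  · have h2 : ∀ i ∈ Finset.range M, (if i + 1 < M + 1 ∧ val B i < val B (i + 1) then (1 : ℤ) else 0)
        = if val B i < val B (i + 1) then 1 else 0 := by
      intro i hi
      simp [Finset.mem_range.mp hi]
    have h3 : ∑ i ∈ Finset.range (M + 1),
        (if i + 1 < M + 1 ∧ val B i < val B (i + 1) then (1 : ℤ) else 0)
        = ∑ i ∈ Finset.range M, if val B i < val B (i + 1) then 1 else 0 := by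
      rw [Finset.sum_range_succ, Finset.sum_congr rfl h2]
      simp
    rw [h3]
    simp [gain]

theorem gain_eq_zero_or_one (N : ℕ) (g : ℕ → ℕ) (p : ℕ) : gain N g p = 0 ∨ gain N g p = 1 := by
  unfold gain; split_ifs <;> simp

theorem sum_positions {N : ℕ} (B : Perm (Fin N)) (k : ℤ) :
    ∑ p : Fin (N + 1), (if (asc (insertMax p B) : ℤ) = k then (1 : ℤ) else 0)
      = (k + 1) * (if (asc B : ℤ) = k then 1 else 0)
        + (N + 1 - k) * (if (asc B : ℤ) = k - 1 then 1 else 0) := by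
  have h : ∀ p : Fin (N + 1), (if (asc (insertMax p B) : ℤ) = k then (1 : ℤ) else 0)
      = (if (asc B : ℤ) = k then 1 else 0) * (1 - (gain N (val B) p : ℤ))
        + (if (asc B : ℤ) = k - 1 then 1 else 0) * (gain N (val B) p : ℤ) := by
    intro p
    rw [asc_insertMax]
    rcases gain_eq_zero_or_one N (val B) p with h | h <;> rw [h] <;> simp [eq_sub_iff_add_eq]
  rw [Finset.sum_congr rfl fun p _ => h p, Finset.sum_add_distrib, ← Finset.mul_sum,
    ← Finset.mul_sum, Finset.sum_sub_distrib, sum_gain]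
  simp only [Finset.sum_const, Finset.card_univ, Fintype.card_fin, nsmul_eq_mul]
  push_cast
  split_ifs with h1 h2 h2
  · omega
  · rw [h1]; ring
  · rw [h2]; ring
  · ring

/-! ### The two recurrences -/

theorem D_succ_of_even {N : ℕ} (hN : Even N) (k : ℤ) :
    D (N + 1) k = (N + 1 - k) * D N (k - 1) + (k + 1) * D N k := by
  rw [← sum_odd_pos_max hN, sum_perm_succ, D_eq_sum, D_eq_sum, Finset.mul_sum, Finset.mul_sum,
    ← Finset.sum_add_distrib]
  refine Finset.sum_congr rfl fun B _ => ?_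
  have h : ∀ p : Fin (N + 1), (if (asc (insertMax p B) : ℤ) = k then
      sgn (insertMax p B) * (-1) ^ pos (insertMax p B) N else 0)
      = sgn B * (if (asc (insertMax p B) : ℤ) = k then (1 : ℤ) else 0) := by
    intro p
    rw [pos_insertMax_max, sgn_insertMax, pow_add, hN.neg_one_pow]
    have : ((-1 : ℤ) ^ (p : ℕ)) * (-1) ^ (p : ℕ) = 1 := by
      rw [← mul_pow]; simp
    split_ifs
    · linear_combination sgn B * this
    · simp
  rw [Finset.sum_congr rfl fun p _ => h p, ← Finset.mul_sum, sum_positions]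
  split_ifs <;> ring

/-- The two largest values stand next to each other. -/
def TopAdjacent {M : ℕ} (A : Perm (Fin (M + 2))) : Prop :=
  pos A M + 1 = pos A (M + 1) ∨ pos A (M + 1) + 1 = pos A M

theorem sum_not_topAdjacent {M : ℕ} (k : ℤ) [DecidablePred (TopAdjacent (M := M))] :
    ∑ A : Perm (Fin (M + 2)), (if (asc A : ℤ) = k ∧ ¬ TopAdjacent A then sgn A else 0) = 0 := by
  let a : Fin (M + 2) := ⟨M, by omega⟩
  let b : Fin (M + 2) := ⟨M + 1, by omega⟩
  have hab : a ≠ b := by simp [a, b, Fin.ext_iff]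
  have hpos : ∀ A : Perm (Fin (M + 2)), pos (swap a b * A) M = pos A (M + 1) ∧
      pos (swap a b * A) (M + 1) = pos A M := fun A => by
    rw [pos_swap_mul, pos_swap_mul]
    exact ⟨by rw [Equiv.swap_apply_left], by rw [Equiv.swap_apply_right]⟩
  have hadj : ∀ A, TopAdjacent (swap a b * A) ↔ TopAdjacent A := fun A => by
    rw [TopAdjacent, TopAdjacent, (hpos A).1, (hpos A).2, or_comm]
  have hasc : ∀ A, ¬ TopAdjacent A → asc (swap a b * A) = asc A := fun A hA => by
    rw [TopAdjacent, not_or] at hA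
    have ha := pos_val A a
    have hb := pos_val A b
    exact asc_swap_mul A rfl (by rw [← ha, ← hb]; exact hA.1) (by rw [← ha, ← hb]; exact hA.2)
  rw [← Finset.sum_filter]
  refine Finset.sum_involution (fun A _ => swap a b * A) ?_ ?_ ?_ ?_
  · intro A _
    rw [sgn_swap_mul A hab]; ring
  · intro A _ hne heq
    have := sgn_swap_mul A hab
    rw [heq] at this
    omega
  · intro A hA
    simp only [Finset.mem_filter, Finset.mem_univ, true_and] at hA ⊢
    rw [hadj, hasc A hA.2]
    exact hA
  · intro A _
    exact Equiv.swap_mul_self_mul _ _ _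

/-- Just left of the old maximum is the front or an ascent; just right of it is a descent or the
end. -/
theorem gain_pos_max {M : ℕ} (B : Perm (Fin (M + 1))) :
    gain (M + 1) (val B) (pos B M) = 0 ∧ gain (M + 1) (val B) (pos B M + 1) = 1 := by
  have hq : pos B M = B.symm (Fin.last M) := pos_val B (Fin.last M)
  have hlt : pos B M < M + 1 := by rw [hq]; exact Fin.is_lt _
  have hv : val B (pos B M) = M := by rw [hq, val_fin, Equiv.apply_symm_apply]; rfl
  have hle : ∀ i, i < M + 1 → val B i ≤ M := fun i hi => by
    rw [val, dif_pos hi]; omega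
  constructor
  · rw [gain, if_neg]
    rintro ⟨h1, h2⟩
    refine h2 ⟨hlt, ?_⟩
    rw [hv]
    refine lt_of_le_of_ne (hle _ (by omega)) fun he => ?_
    rw [val, dif_pos (by omega)] at he
    have : (⟨pos B M - 1, by omega⟩ : Fin (M + 1)) = B.symm (Fin.last M) := by
      rw [Equiv.eq_symm_apply]; exact Fin.ext he
    have := congrArg Fin.val this
    rw [← hq] at this
    simp only at this
    omega
  · rw [gain, if_pos]
    refine ⟨by omega, fun h => ?_⟩
    have := hle _ h.1
    have h2 := h.2
    rw [Nat.add_sub_cancel, hv] at h2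
    omega

theorem D_succ_of_odd {M : ℕ} (hM : Even M) (k : ℤ) :
    D (M + 2) k = D (M + 1) (k - 1) - D (M + 1) k := by
  classical
  have h0 : D (M + 2) k
      = ∑ A : Perm (Fin (M + 2)), if (asc A : ℤ) = k ∧ TopAdjacent A then sgn A else 0 := by
    rw [D_eq_sum, ← sub_eq_zero, ← Finset.sum_sub_distrib]
    refine Eq.trans ?_ (sum_not_topAdjacent (M := M) k)
    refine Finset.sum_congr rfl fun A _ => ?_
    by_cases h1 : TopAdjacent A <;> by_cases h2 : (asc A : ℤ) = k <;> simp [h1, h2]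
  -- The weights (-1)^position introduced on the right match the signs of insertion next to the old
  -- maximum.
  rw [h0, sum_perm_succ, ← sum_odd_pos_max hM, ← sum_odd_pos_max hM, ← Finset.sum_sub_distrib]
  refine Finset.sum_congr rfl fun B _ => ?_
  have hlt : pos B M < M + 1 := by
    rw [pos, dif_pos (by omega)]; exact Fin.is_lt _
  have hadj : ∀ p : Fin (M + 2), TopAdjacent (insertMax p B) ↔
      p = ⟨pos B M, by omega⟩ ∨ p = ⟨pos B M + 1, by omega⟩ := by
    intro p
    have h := pos_insertMax p B (Fin.last M)
    rw [Fin.val_last] at h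
    rw [TopAdjacent, pos_insertMax_max, h, Fin.ext_iff, Fin.ext_iff]
    split_ifs <;> simp only <;> omega
  have hne : (⟨pos B M, by omega⟩ : Fin (M + 2)) ≠ ⟨pos B M + 1, by omega⟩ := by
    simp [Fin.ext_iff]
  simp_rw [and_comm (b := TopAdjacent _), ite_and, hadj]
  rw [← Finset.sum_filter, Finset.filter_or, Finset.filter_eq' , Finset.filter_eq',
    if_pos (Finset.mem_univ _), if_pos (Finset.mem_univ _), Finset.sum_union (by simp [hne]),
    Finset.sum_singleton, Finset.sum_singleton]
  simp only [asc_insertMax, sgn_insertMax, (gain_pos_max B).1, (gain_pos_max B).2]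
  have e : (-1 : ℤ) ^ (M + 1) = -1 := hM.add_one.neg_one_pow
  simp only [pow_add _ (M + 1), e, pow_succ _ (pos B M), Nat.cast_add, Nat.cast_one,
    add_zero, eq_sub_iff_add_eq]
  split_ifs <;> ring

end PAP

theorem theorem4p3 (n : ℕ) (hn : 1 ≤ n) (k : ℤ) (hk0 : 0 ≤ k) (hk1 : k ≤ (n : ℤ) - 1) :
    PAP.R n k = PAP.D n k ∧
    (Odd n → PAP.R n k =
      ((n : ℤ) - k) * PAP.R (n - 1) (k - 1) + (k + 1) * PAP.R (n - 1) k) ∧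
    (Even n → PAP.R n k = PAP.R (n - 1) (k - 1) - PAP.R (n - 1) k) := by
  simp only [PAP.R_eq_D, true_and]
  constructor
  · intro ho
    obtain ⟨m, rfl⟩ := ho
    simpa using PAP.D_succ_of_even (even_two_mul m) k
  · intro he
    obtain ⟨m, rfl⟩ : ∃ m, n = 2 * m + 2 := by
      obtain ⟨r, hr⟩ := he
      exact ⟨r - 1, by omega⟩
    exact PAP.D_succ_of_odd (even_two_mul m) k
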